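/- Let $n\ge 2$. Write $B^n(x,r)$, $\overline B^n(x,r)$, $S^{n-1}(x,r)$ for the open ball, the closed ball and the sphere in $\mathbb R^n$; let $\Omega_n$ be the volume of the unit ball, $\omega_{n-1}=n\Omega_n$ the area of the unit sphere, and $$K_n=2^{-n}\omega_{n-1}^n\Omega_n^{1-n}=\frac1{\Gamma(\frac n2+1)}\left(\frac{n\sqrt\pi}{2}\right)^n .$$ A *measure function* is an increasing continuous function $h$ on $(0,\infty)$ with $h(r)\to0$ as $r\to0$ and $h(r)\to\infty$ as $r\to\infty$. The *$h$-Hausdorff content* of $E\subset\mathbb R^n$ is $\Lambda_h(E)=\inf\sum_k h(r_k)$, the infimum over all countable covers of $E$ by open balls $B^n(a_k,r_k)$, $r_k>0$. For a family $\Gamma$ of closed paths in $\mathbb R^n$ let $\mathsf M(\Gamma)=\inf_\rho\int_{\mathbb R^n}\rho^n\,dm$ be its conformal modulus, the infimum over all Borel functions $\rho:\mathbb R^n\to[0,\infty]$ with $\int_\gamma\rho\,ds\ge1$ for every rectifiable $\gamma\in\Gamma$. For $x\in\mathbb R^n$, $r>0$ and closed $E\subset\mathbb R^n$ let $\mathrm{cap}(x,E,r)=\mathsf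 M(\Gamma)$, where $\Gamma$ is the family of all closed paths in $\mathbb R^n$ with one endpoint in $S^{n-1}(x,2r)$ and the other in $E\cap\overline B^n(x,r)$. Call a natural number $N$ a *covering constant* in dimension $n$ if, whenever a radius $r(x)>0$ is assigned to each point $x$ of a set $A\subset\mathbb R^n$ with $\sup_{x\in A}r(x)<\infty$, there is a countable subset $\{x_k\}\subset A$ such that the balls $B^n(x_k,r(x_k))$ cover $A$ and no point of $\mathbb R^n$ lies in more than $N$ of them. Let $\kappa(n)$ be the kissing number, i.e. the maximal number of points of the unit sphere whose pairwise angles (seen from the origin) are at least $\pi/3$. **Theorem.** (a) There is a least covering constant $N_n^*$ in dimension $n$, and $N_n^*\le\kappa(n)+1$. (b) Let $N_n$ be any covering constant in dimension $n$ (for example $N_n=N_n^*$). Suppose that the measure function $h$ satisfies $$\int_0^{2r}h(t)^{1/n}\,t^{-1}\,dt\le A\,h(r)^{1/n},\qquad 0<r\le r_0,$$ for some constants $A>0$ and $r_0>0$. Then for every closed set $E\subset\mathbb R^n$ $$\frac{\Lambda_h(E\cap\overline B^n(x,r))}{h(r)}\le M_1\cdot\mathrm{cap}(x,E,r),\qquad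 x\in\mathbb R^n,\ 0<r\le r_0,$$ where $$M_1=\max\left\{\frac{2^nA^n}{\Omega_n}\left(\frac{n-1}{n}\right)^nN_n,\ \frac1{K_n}\right\}.$$ -/

import Mathlib

open Set MeasureTheory Metric
open scoped ENNReal NNReal

noncomputable section

/-- Euclidean space `ℝⁿ`. -/
abbrev Rn (n : ℕ) : Type := EuclideanSpace ℝ (Fin n)

/-- `Ω_n`, the volume of the unit ball of `ℝⁿ`. -/
def ballVolume (n : ℕ) : ℝ := (volume : Measure (Rn n)).real (ball 0 1)

/-- `ω_{n-1}`, the surface area of the unit sphere of `ℝⁿ`. -/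
def sphereArea (n : ℕ) : ℝ := (volume : Measure (Rn n)).toSphere.real univ

/-- `K_n = 2⁻ⁿ ω_{n-1}ⁿ Ω_n^{1-n}`. -/
def constK (n : ℕ) : ℝ :=
  (2 : ℝ) ^ (-(n : ℤ)) * sphereArea n ^ n * ballVolume n ^ (1 - (n : ℤ))

/-! ### Curve families and their conformal modulus -/

/-- A closed path in `ℝⁿ`: a continuous map `[a, b] → ℝⁿ`
(the values of `toFun` outside `[a, b]` play no role). -/
structure ClosedPath (n : ℕ) where
  a : ℝ
  b : ℝ
  hab : a ≤ b
  toFun : ℝ → Rn n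
  cont : ContinuousOn toFun (Icc a b)

/-- The length of a path. -/
def ClosedPath.length {n : ℕ} (γ : ClosedPath n) : ℝ≥0∞ :=
  eVariationOn γ.toFun (Icc γ.a γ.b)

/-- A path is rectifiable if its length is finite. -/
def ClosedPath.Rectifiable {n : ℕ} (γ : ClosedPath n) : Prop := γ.length ≠ ∞

/-- The line integral `∫_γ ρ ds` along a rectifiable path, computed in the
parametrization of `γ` by arc length. -/
def ClosedPath.lineIntegral {n : ℕ} (γ : ClosedPath n) (ρ : Rn n → ℝ≥0∞) : ℝ≥0∞ :=
  ∫⁻ s in Icc 0 γ.length.toReal,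
    ρ (naturalParameterization γ.toFun (Icc γ.a γ.b) γ.a s)

/-- `Δ(E, F; G)`: the paths that lie in `G` except for their endpoints and that have one
endpoint in `E` and the other one in `F`. -/
def joiningPaths {n : ℕ} (E F G : Set (Rn n)) : Set (ClosedPath n) :=
  {γ | ((γ.toFun γ.a ∈ E ∧ γ.toFun γ.b ∈ F) ∨ (γ.toFun γ.a ∈ F ∧ γ.toFun γ.b ∈ E)) ∧
    ∀ t ∈ Ioo γ.a γ.b, γ.toFun t ∈ G}

/-- Borel densities `ρ : ℝⁿ → [0, ∞]` with `∫_γ ρ ds ≥ 1` for all rectifiable `γ ∈ Γ`. -/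
def Admissible {n : ℕ} (Γ : Set (ClosedPath n)) (ρ : Rn n → ℝ≥0∞) : Prop :=
  Measurable ρ ∧ ∀ γ ∈ Γ, γ.Rectifiable → 1 ≤ γ.lineIntegral ρ

/-- The conformal modulus `M(Γ) = inf ∫ ρⁿ dm` over the admissible `ρ`. -/
def modulus {n : ℕ} (Γ : Set (ClosedPath n)) : ℝ≥0∞ :=
  ⨅ (ρ : Rn n → ℝ≥0∞) (_ : Admissible Γ ρ), ∫⁻ y, ρ y ^ n

/-- `cap(x, E, r) = M(Δ(S^{n-1}(x, 2r), E ∩ B̄ⁿ(x, r); ℝⁿ))`. -/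
def localCap {n : ℕ} (x : Rn n) (E : Set (Rn n)) (r : ℝ) : ℝ≥0∞ :=
  modulus (joiningPaths (sphere x (2 * r)) (E ∩ closedBall x r) univ)

/-! ### Measure functions and Hausdorff content -/

/-- A measure function: increasing and continuous on `(0, ∞)`, with limit `0` at `0` and
limit `∞` at `∞`. -/
structure IsMeasureFunction (h : ℝ → ℝ) : Prop where
  mono : MonotoneOn h (Ioi 0)
  cont : ContinuousOn h (Ioi 0)
  tendsto_zero : Filter.Tendsto h (nhdsWithin 0 (Ioi 0)) (nhds 0)
  tendsto_top : Filter.Tendsto h Filter.atTop Filter.atTop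

/-- The Hausdorff content `Λ_h(E)`: the infimum of `∑ h(r_k)` over the countable (finite or
infinite) covers of `E` by open balls `Bⁿ(a_k, r_k)`, `r_k > 0`. A cover is given as the set of
the pairs `(a_k, r_k)`. -/
def hausdorffContent {n : ℕ} (h : ℝ → ℝ) (E : Set (Rn n)) : ℝ≥0∞ :=
  ⨅ (C : Set (Rn n × ℝ)) (_ : C.Countable) (_ : ∀ p ∈ C, 0 < p.2)
    (_ : E ⊆ ⋃ p ∈ C, ball p.1 p.2), ∑' p : C, ENNReal.ofReal (h p.1.2)

/-! ### Covering constants and the kissing number -/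

/-- `N` is a covering constant in dimension `n`: whenever a radius `r x > 0` is assigned to each
point `x` of a set `A`, with `r` bounded on `A`, there is a countable `S ⊆ A` such that the open
balls `Bⁿ(x, r x)`, `x ∈ S`, cover `A` and no point of `ℝⁿ` lies in more than `N` of them. -/
def IsCoveringConstant (n N : ℕ) : Prop :=
  ∀ (A : Set (Rn n)) (r : Rn n → ℝ), (∀ x ∈ A, 0 < r x) → BddAbove (r '' A) →
    ∃ S ⊆ A, S.Countable ∧ A ⊆ ⋃ x ∈ S, ball x (r x) ∧
      ∀ y, {x ∈ S | y ∈ ball x (r x)}.encard ≤ N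

/-- The unit vectors in `V` have pairwise angles at least `φ`. -/
def IsAngleSeparated {n : ℕ} (φ : ℝ) (V : Set (Rn n)) : Prop :=
  V ⊆ sphere 0 1 ∧ V.Pairwise fun P Q => φ ≤ InnerProductGeometry.angle P Q

/-- The kissing number `κ(n)`: the maximal cardinality of a `π/3`-separated subset of the unit
sphere. -/
def kissingNumber (n : ℕ) : ℕ∞ :=
  ⨆ (V : Set (Rn n)) (_ : IsAngleSeparated (Real.pi / 3) V), V.encard

/-- `M₁ = max {2ⁿ Aⁿ ((n-1)/n)ⁿ N / Ω_n, 1 / K_n}`. -/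
def constM (n : ℕ) (A : ℝ) (N : ℕ) : ℝ :=
  max (2 ^ n * A ^ n * (((n : ℝ) - 1) / n) ^ n * N / ballVolume n) (1 / constK n)

end

/-!
**Covering constants.** Sort the balls by radius into the geometric classes
`(q ^ (k + 1) R, q ^ k R]` with `q < 1` close to `1`, and pick in the `k`-th class a maximal
separated set of the centres that are not covered by the balls picked before
(`exists_almost_greedy_cover`). If `y` lies in several of the selected balls, the distance of any
two of their centres is at least the larger radius, up to the factor `q`. Hence at most one centre
is close to `y` relative to its radius, and the directions from `y` to the others have pairwise
angles at least `π / 3 - ε`. By compactness of the sphere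
(`exists_pos_forall_encard_le_kissingNumber`) there are at most `κ(n)` such directions if `ε` is
small, so `κ(n) + 1` is a covering constant.

**Capacity and content.** Let `ρ` be admissible. Since `Λ_h(E ∩ B̄(x, r)) ≤ h(r)`, the estimate
holds with the factor `1 / K_n` if `∫ ρⁿ ≥ K_n`. Otherwise let `z ∈ E ∩ B̄(x, r)`. Every ray from
`z` meets `S(x, 2r)`, so `∫ ρ ds ≥ 1` along it; integrating over the directions bounds the area
`ω_{n-1}` by the Riesz potential
`∫ ρ(y) |y - z| ^ (1 - n) dy = (n - 1) ∫₀^∞ t ^ (-n) (∫_{B(z,t)} ρ) dt`, where `ρ` is cut off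
outside `B̄(x, 2r)` (`lintegral_rays_le`). By Hölder's inequality the part `t ≥ 2r` is at most
`Ω_n ^ (1 - 1/n) (∫ ρⁿ) ^ (1/n) < ω_{n-1} / 2` (`lintegral_rays_closedBall_le`). The part `t < 2r`
thus exceeds `ω_{n-1} / 2`, and in view of the integral condition on `h` this forces
`∫_{B(z,t)} ρⁿ > c h(t)` for some `t < 2r`, with an explicit constant `c`
(`exists_lt_lintegral_ball`). A subcover of these balls with multiplicity at most `N` gives
`c Λ_h(E ∩ B̄(x, r)) ≤ N ∫ ρⁿ` (`mul_hausdorffContent_le`).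
-/

/-! ### Separated subsets of the unit sphere -/

theorem pi_div_three_le_angle_iff {n : ℕ} {P Q : Rn n} (hP : ‖P‖ = 1) (hQ : ‖Q‖ = 1) :
    Real.pi / 3 ≤ InnerProductGeometry.angle P Q ↔ inner ℝ P Q ≤ 1 / 2 := by
  have hcos : Real.cos (InnerProductGeometry.angle P Q) = inner ℝ P Q := by
    rw [InnerProductGeometry.cos_angle, hP, hQ]; simp
  have h0 := InnerProductGeometry.angle_nonneg P Q
  have h1 := InnerProductGeometry.angle_le_pi P Q
  have hpi := Real.pi_pos
  rw [← hcos, ← Real.cos_pi_div_three]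
  refine (Real.strictAntiOn_cos.le_iff_ge ⟨h0, h1⟩ ⟨by positivity, by linarith⟩).symm

theorem encard_le_kissingNumber {n : ℕ} {V : Set (Rn n)} (hV : V ⊆ sphere 0 1)
    (hs : V.Pairwise fun P Q => inner ℝ P Q ≤ (1 / 2 : ℝ)) : V.encard ≤ kissingNumber n := by
  refine le_iSup₂_of_le V ⟨hV, fun P hP Q hQ hne => ?_⟩ le_rfl
  exact (pi_div_three_le_angle_iff (by simpa using hV hP) (by simpa using hV hQ)).2
    (hs hP hQ hne)

/-- The kissing number is finite: a ball of radius `1 / 2` contains at most one point of a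
`π / 3`-separated set, and finitely many such balls cover the sphere. -/
theorem kissingNumber_ne_top (n : ℕ) : kissingNumber n ≠ ⊤ := by
  obtain ⟨t, -, ht, hcov⟩ := (isCompact_sphere (0 : Rn n) 1).finite_cover_balls
    (e := 1 / 2) (by norm_num)
  refine ne_top_of_le_ne_top (Set.encard_ne_top_iff.2 ht) (iSup₂_le fun V hV => ?_)
  have hx : ∀ P : V, ∃ c ∈ t, (P : Rn n) ∈ ball c (1 / 2) := fun P => by
    simpa using hcov (hV.1 P.2)
  choose f hft hf using hx
  have hinj : Function.Injective f := by
    intro P Q hPQ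
    by_contra hne
    have hne' : (P : Rn n) ≠ Q := fun h => hne (Subtype.ext h)
    have hP : ‖(P : Rn n)‖ = 1 := by simpa using hV.1 P.2
    have hQ : ‖(Q : Rn n)‖ = 1 := by simpa using hV.1 Q.2
    have hin := (pi_div_three_le_angle_iff hP hQ).1 (hV.2 P.2 Q.2 hne')
    have hd : dist (P : Rn n) Q < 1 := by
      have h1 := mem_ball.1 (hf P)
      have h2 := mem_ball'.1 (hf Q)
      rw [← hPQ] at h2
      linarith [dist_triangle (P : Rn n) (f P) Q]
    have hsq := norm_sub_sq_real (P : Rn n) Q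
    rw [hP, hQ] at hsq
    rw [dist_eq_norm] at hd
    nlinarith [norm_nonneg ((P : Rn n) - Q)]
  calc V.encard = (range f).encard := by
        rw [← image_univ, hinj.encard_image, encard_univ, ENat.card_coe_set_eq]
    _ ≤ t.encard := encard_le_encard (range_subset_iff.2 hft)

/-- By compactness, the bound given by the kissing number persists when the lower bound `π / 3`
on the angles is relaxed slightly. -/
theorem exists_pos_forall_encard_le_kissingNumber (n : ℕ) :
    ∃ δ : ℝ, 0 < δ ∧ δ ≤ 1 / 4 ∧ ∀ V : Set (Rn n), V ⊆ sphere 0 1 →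
      (V.Pairwise fun P Q => inner ℝ P Q ≤ 1 / 2 + δ) → V.encard ≤ kissingNumber n := by
  obtain ⟨K, hK⟩ := ENat.ne_top_iff_exists.1 (kissingNumber_ne_top n)
  let U : ℕ → Set (Fin (K + 1) → Rn n) := fun m =>
    ⋃ (i : Fin (K + 1)) (j : Fin (K + 1)) (_ : i ≠ j),
      {v | 1 / 2 + 1 / ((m : ℝ) + 4) < inner ℝ (v i) (v j)}
  have hU : ∀ m, IsOpen (U m) := fun m => by
    refine isOpen_iUnion fun i => isOpen_iUnion fun j => isOpen_iUnion fun _ => ?_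
    exact isOpen_lt continuous_const (by fun_prop)
  have hmono : Monotone U := by
    intro m m' hm v hv
    simp only [U, mem_iUnion, mem_ofPred_eq] at hv ⊢
    obtain ⟨i, j, hij, h⟩ := hv
    refine ⟨i, j, hij, lt_of_le_of_lt ?_ h⟩
    gcongr
  have hcpt : IsCompact (Set.pi univ fun _ : Fin (K + 1) => sphere (0 : Rn n) 1) :=
    isCompact_univ_pi fun _ => isCompact_sphere _ _
  have hcov : (Set.pi univ fun _ : Fin (K + 1) => sphere (0 : Rn n) 1) ⊆ ⋃ m, U m := by
    intro v hv
    have hv1 : ∀ i, ‖v i‖ = 1 := fun i => by simpa using hv i (mem_univ i)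
    -- Otherwise the `K + 1` vectors would be distinct and `π / 3`-separated.
    have hex : ∃ i j, i ≠ j ∧ (1 / 2 : ℝ) < inner ℝ (v i) (v j) := by
      by_contra! hcon
      have hinj : Function.Injective v := by
        intro i j hij
        by_contra hne
        have := hcon i j hne
        rw [hij, real_inner_self_eq_norm_sq, hv1] at this
        norm_num at this
      have hle := encard_le_kissingNumber (V := range v)
        (range_subset_iff.2 fun i => by simpa using hv1 i) (by
          rintro _ ⟨i, rfl⟩ _ ⟨j, rfl⟩ hne
          exact hcon i j fun h => hne (by rw [h]))
      rw [← image_univ, hinj.encard_image, encard_univ, ← hK] at hle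
      simp only [ENat.card_eq_coe_fintype_card, Fintype.card_fin, Nat.cast_le] at hle
      omega
    obtain ⟨i, j, hij, h⟩ := hex
    obtain ⟨m, hm⟩ := exists_nat_one_div_lt (sub_pos.2 h)
    refine mem_iUnion.2 ⟨m, ?_⟩
    simp only [U, mem_iUnion, mem_ofPred_eq]
    refine ⟨i, j, hij, ?_⟩
    have : 1 / ((m : ℝ) + 4) ≤ 1 / ((m : ℝ) + 1) := by gcongr; norm_num
    linarith
  obtain ⟨m, hm⟩ := hcpt.elim_directed_cover U hU hcov hmono.directed_le
  refine ⟨1 / ((m : ℝ) + 4), by positivity, by gcongr; simp, fun V hV hs => ?_⟩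
  by_contra! hlt
  rw [← hK] at hlt
  have hle : ((K + 1 : ℕ) : ℕ∞) ≤ V.encard := by
    push_cast
    exact Order.add_one_le_of_lt hlt
  obtain ⟨W, hWV, hW⟩ := exists_subset_encard_eq hle
  have hWf : W.Finite := finite_of_encard_eq_coe hW
  have : Fintype W := hWf.fintype
  have hcard : Fintype.card W = K + 1 := by
    have : W.ncard = K + 1 := by rw [ncard_def, hW]; rfl
    rw [← this, ← Nat.card_coe_set_eq, Nat.card_eq_fintype_card]
  let e : Fin (K + 1) ≃ W := (Fintype.equivFinOfCardEq hcard).symm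
  have hmem := hm (show (fun i => (e i : Rn n)) ∈ _ from fun i _ => hV (hWV (e i).2))
  simp only [U, mem_iUnion, mem_ofPred_eq] at hmem
  obtain ⟨i, j, hij, h⟩ := hmem
  exact absurd (hs (hWV (e i).2) (hWV (e j).2) fun h => hij (e.injective (Subtype.ext h)))
    (not_le.2 h)

/-! ### Selection of a covering subfamily of balls -/

/-- A maximal `ρ`-separated subset of `U` is a `ρ`-net of `U`. -/
theorem exists_separated_net {X : Type*} [PseudoMetricSpace X] (U : Set X) (ρ : ℝ) (hρ : 0 < ρ) :
    ∃ M ⊆ U, (M.Pairwise fun x y => ρ ≤ dist x y) ∧ ∀ z ∈ U, ∃ x ∈ M, dist z x < ρ := by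
  obtain ⟨M, hM⟩ := zorn_subset {M : Set X | M ⊆ U ∧ M.Pairwise fun x y => ρ ≤ dist x y} (by
    intro c hc hchain
    refine ⟨⋃₀ c, ⟨sUnion_subset fun s hs => (hc hs).1, ?_⟩, fun s hs => subset_sUnion_of_mem hs⟩
    exact (pairwise_sUnion hchain.directedOn).2 fun s hs => (hc hs).2)
  refine ⟨M, hM.prop.1, hM.prop.2, fun z hz => ?_⟩
  by_contra! hcon
  have hins : insert z M ∈ {M : Set X | M ⊆ U ∧ M.Pairwise fun x y => ρ ≤ dist x y} := by
    refine ⟨insert_subset hz hM.prop.1, hM.prop.2.insert fun x hx _ => ⟨hcon x hx, ?_⟩⟩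
    rw [dist_comm]
    exact hcon x hx
  have hzM : z ∈ M := hM.le_of_ge hins (subset_insert z M) (mem_insert z M)
  have := hcon z hzM
  rw [dist_self] at this
  linarith

theorem countable_of_pairwise_le_dist {X : Type*} [PseudoMetricSpace X]
    [TopologicalSpace.SeparableSpace X] {M : Set X} {ρ : ℝ} (hρ : 0 < ρ)
    (hM : M.Pairwise fun x y => ρ ≤ dist x y) : M.Countable := by
  refine PairwiseDisjoint.countable_of_isOpen (s := fun x => ball x (ρ / 2)) ?_
    (fun x _ => isOpen_ball) (fun x _ => ⟨x, mem_ball_self (by positivity)⟩)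
  intro x hx y hy hne
  exact ball_disjoint_ball (by linarith [hM hx hy hne])

/-- Selection of balls whose radii decrease up to the factor `q`: the radii are sorted into the
classes `(q ^ (k + 1) * R, q ^ k * R]`, and the `k`-th step picks a maximal separated set among
the centres of the `k`-th class that are not covered yet. Two selected centres are separated by
the larger radius, or they belong to the same class and are separated up to the factor `q`. -/
theorem exists_almost_greedy_cover {X : Type*} [PseudoMetricSpace X]
    [TopologicalSpace.SeparableSpace X] {A : Set X} {r : X → ℝ} (hr : ∀ x ∈ A, 0 < r x)
    (hbdd : BddAbove (r '' A)) {q : ℝ} (hq0 : 0 < q) (hq1 : q < 1) :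
    ∃ S ⊆ A, S.Countable ∧ A ⊆ ⋃ x ∈ S, ball x (r x) ∧
      S.Pairwise fun x y => max (r x) (r y) ≤ dist x y ∨
        (q * max (r x) (r y) ≤ dist x y ∧ q * r x ≤ r y ∧ q * r y ≤ r x) := by
  obtain ⟨R₀, hR₀⟩ := hbdd
  obtain ⟨R, hR, hRA⟩ : ∃ R : ℝ, 0 < R ∧ ∀ x ∈ A, r x ≤ R :=
    ⟨max R₀ 1, by positivity, fun x hx => (hR₀ (mem_image_of_mem r hx)).trans (le_max_left _ _)⟩
  let U : ℕ → Set X → Set X := fun k T =>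
    {x ∈ A | (q ^ (k + 1) * R < r x ∧ r x ≤ q ^ k * R) ∧ x ∉ ⋃ z ∈ T, ball z (r z)}
  choose M hMU hMsep hMnet using fun k T =>
    exists_separated_net (U k T) (q ^ (k + 1) * R) (by positivity)
  let T : ℕ → Set X := fun k => Nat.rec ∅ (fun k T => T ∪ M k T) k
  have hTsucc : ∀ k, T (k + 1) = T k ∪ M k (T k) := fun k => rfl
  have hTmono : Monotone T := monotone_nat_of_le_succ fun k => by
    rw [hTsucc]; exact subset_union_left
  have hMT : ∀ k, M k (T k) ⊆ T (k + 1) := fun k => by rw [hTsucc]; exact subset_union_right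
  have hTS : ∀ k, T k ⊆ ⋃ k, M k (T k) := by
    intro k
    induction k with
    | zero => exact empty_subset _
    | succ k ih =>
      rw [hTsucc]
      exact union_subset ih (subset_iUnion (fun k => M k (T k)) k)
  refine ⟨⋃ k, M k (T k), iUnion_subset fun k x hx => (hMU k _ hx).1,
    countable_iUnion fun k => countable_of_pairwise_le_dist (by positivity) (hMsep k (T k)),
    fun x hx => ?_, ?_⟩
  · obtain ⟨k, hk1, hk2⟩ := exists_nat_pow_near_of_lt_one (x := r x / R) (div_pos (hr x hx) hR)
      ((div_le_one hR).2 (hRA x hx)) hq0 hq1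
    rw [lt_div_iff₀ hR] at hk1
    rw [div_le_iff₀ hR] at hk2
    by_cases hcov : x ∈ ⋃ z ∈ T k, ball z (r z)
    · exact biUnion_subset_biUnion_left (hTS k) hcov
    · obtain ⟨z, hz, hxz⟩ := hMnet k (T k) x ⟨hx, ⟨hk1, hk2⟩, hcov⟩
      exact mem_biUnion (mem_iUnion.2 ⟨k, hz⟩) (mem_ball.2 (hxz.trans (hMU k _ hz).2.1.1))
  · -- Centres of different classes: the later one is not covered by the earlier ball.
    have key : ∀ k l, k < l → ∀ x ∈ M k (T k), ∀ y ∈ M l (T l), max (r x) (r y) ≤ dist x y := by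
      intro k l hkl x hx y hy
      have hxT : x ∈ T l := hTmono hkl (hMT k hx)
      have hxy : r x ≤ dist y x := by
        by_contra! hlt
        exact (hMU l _ hy).2.2 (mem_biUnion hxT (mem_ball.2 hlt))
      have h1 := (hMU k _ hx).2.1.1
      have h2 := (hMU l _ hy).2.1.2
      have h3 : q ^ l * R ≤ q ^ (k + 1) * R :=
        mul_le_mul_of_nonneg_right (pow_le_pow_of_le_one hq0.le hq1.le hkl) hR.le
      rw [dist_comm x y]
      exact max_le hxy (by linarith)
    intro x hx y hy hne
    obtain ⟨k, hk⟩ := mem_iUnion.1 hx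
    obtain ⟨l, hl⟩ := mem_iUnion.1 hy
    rcases lt_trichotomy k l with hkl | rfl | hkl
    · exact Or.inl (key k l hkl x hk y hl)
    · have hx' := (hMU k _ hk).2.1
      have hy' := (hMU k _ hl).2.1
      have hx2 : q * r x ≤ q ^ (k + 1) * R := by
        rw [pow_succ']; nlinarith [hx'.2]
      have hy2 : q * r y ≤ q ^ (k + 1) * R := by
        rw [pow_succ']; nlinarith [hy'.2]
      refine Or.inr ⟨?_, by linarith [hy'.1], by linarith [hx'.1]⟩
      refine le_trans ?_ (hMsep k (T k) hk hl hne)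
      rw [mul_max_of_nonneg _ _ hq0.le]
      exact max_le hx2 hy2
    · rw [max_comm, dist_comm]
      exact Or.inl (key l k hkl y hl x hk)

/-! ### The multiplicity of the selected cover -/

/-- If `v` is not longer than `u`, not much shorter than a third of it, and almost as far from `u`
as `0` is, then the angle between `u` and `v` is at least almost `π / 3`. -/
theorem inner_le_of_almost_far {F : Type*} [NormedAddCommGroup F] [InnerProductSpace ℝ F]
    {u v : F} {δ : ℝ} (hδ0 : 0 < δ) (hδ1 : δ ≤ 1 / 4) (hvu : ‖v‖ ≤ ‖u‖)
    (hfar : (1 - δ / 5) * ‖u‖ ≤ ‖u - v‖) (hlarge : (1 - δ / 5) * ‖u‖ ≤ 3 * ‖v‖) :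
    inner ℝ u v ≤ (1 / 2 + δ) * (‖u‖ * ‖v‖) := by
  have hsq := norm_sub_sq_real u v
  have hu := norm_nonneg u
  have hv := norm_nonneg v
  have h1 : ((1 - δ / 5) * ‖u‖) ^ 2 ≤ ‖u - v‖ ^ 2 :=
    pow_le_pow_left₀ (mul_nonneg (by linarith) hu) hfar 2
  have h2 : ‖v‖ ^ 2 ≤ ‖u‖ * ‖v‖ := by nlinarith
  have h3 : (1 - δ / 5) * ‖u‖ ^ 2 ≤ 3 * (‖u‖ * ‖v‖) := by nlinarith
  -- With `q = 1 - δ / 5`: `1 - q² ≤ 2 (1 - q) = 2 δ / 5`, while `‖u‖² ≤ 4 ‖u‖ ‖v‖`.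
  have h4 : ‖u‖ ^ 2 ≤ 4 * (‖u‖ * ‖v‖) := by nlinarith [sq_nonneg ‖u‖]
  have h5 : (1 - (1 - δ / 5) ^ 2) * ‖u‖ ^ 2 ≤ (2 * δ / 5) * ‖u‖ ^ 2 :=
    mul_le_mul_of_nonneg_right (by nlinarith [sq_nonneg δ]) (sq_nonneg _)
  nlinarith [mul_le_mul_of_nonneg_left h4 hδ0.le, mul_nonneg hu hv]

theorem inner_le_of_far {F : Type*} [NormedAddCommGroup F] [InnerProductSpace ℝ F]
    {u v : F} (hu' : ‖u‖ ≤ ‖u - v‖) (hv' : ‖v‖ ≤ ‖u - v‖) :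
    inner ℝ u v ≤ (1 / 2) * (‖u‖ * ‖v‖) := by
  have hsq := norm_sub_sq_real u v
  have hu := norm_nonneg u
  have hv := norm_nonneg v
  rcases le_total ‖u‖ ‖v‖ with h | h <;> nlinarith

/-- A point `y` lies in at most `κ(n) + 1` of the selected balls: at most one of their centres is
close to `y` relative to its radius, and the directions from `y` to the other centres form almost
`π / 3`-separated unit vectors. -/
theorem isCoveringConstant_of_kissingNumber_add_one {n N : ℕ}
    (hN : kissingNumber n + 1 ≤ N) : IsCoveringConstant n N := by
  obtain ⟨δ, hδ0, hδ1, hδ⟩ := exists_pos_forall_encard_le_kissingNumber n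
  intro A r hr hbdd
  obtain ⟨S, hSA, hSc, hcov, hsep⟩ :=
    exists_almost_greedy_cover hr hbdd (q := 1 - δ / 5) (by linarith) (by linarith)
  refine ⟨S, hSA, hSc, hcov, fun y => le_trans ?_ hN⟩
  set F := {x ∈ S | y ∈ ball x (r x)} with hF
  -- The centres of the balls containing `y` that are not close to `y` relative to their radius.
  set G := {x ∈ F | r x ≤ 3 * ‖x - y‖} with hG
  have hFr : ∀ x ∈ F, ‖x - y‖ < r x := fun x hx => by
    have := mem_ball'.1 hx.2
    rwa [dist_eq_norm] at this
  have hq : ∀ x ∈ F, ∀ z ∈ F, x ≠ z → (1 - δ / 5) * max (r x) (r z) ≤ dist x z := by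
    intro x hx z hz hne
    rcases hsep hx.1 hz.1 hne with h | h
    · have : 0 ≤ max (r x) (r z) := le_max_of_le_left (hr x (hSA hx.1)).le
      nlinarith
    · exact h.1
  -- Two close centres would have distance less than `2 / 3` of the larger radius.
  have hsub : (F \ G).Subsingleton := by
    intro x hx z hz
    by_contra hne
    have h1 := hq x hx.1 z hz.1 hne
    have h2 : 3 * ‖x - y‖ < r x := by
      by_contra! hle
      exact hx.2 ⟨hx.1, hle⟩
    have h3 : 3 * ‖z - y‖ < r z := by
      by_contra! hle
      exact hz.2 ⟨hz.1, hle⟩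
    have h4 : dist x z ≤ ‖x - y‖ + ‖z - y‖ := by
      rw [← dist_eq_norm, ← dist_eq_norm]
      exact dist_triangle_right x z y
    have h5 := le_max_left (r x) (r z)
    have h6 := le_max_right (r x) (r z)
    have h7 := hr x (hSA hx.1.1)
    nlinarith
  have hpos : ∀ x ∈ G, 0 < ‖x - y‖ := fun x hx => by
    have := hr x (hSA hx.1.1)
    linarith [hx.2]
  have hinner : ∀ x ∈ G, ∀ z ∈ G, x ≠ z →
      inner ℝ (x - y) (z - y) ≤ (1 / 2 + δ) * (‖x - y‖ * ‖z - y‖) := by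
    intro x hx z hz hne
    have hxr := hFr x hx.1
    have hzr := hFr z hz.1
    have hd : ‖(x - y) - (z - y)‖ = dist x z := by rw [dist_eq_norm]; congr 1; abel
    have hd' : ‖(z - y) - (x - y)‖ = dist x z := by rw [norm_sub_rev, hd]
    have hl := le_max_left (r x) (r z)
    have hm := le_max_right (r x) (r z)
    have hp := mul_pos (hpos x hx) (hpos z hz)
    rcases hsep hx.1.1 hz.1.1 hne with h | ⟨h, hxz, hzx⟩
    · refine (inner_le_of_far (by rw [hd]; linarith) (by rw [hd]; linarith)).trans ?_
      nlinarith
    · have hx3 := hx.2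
      have hz3 := hz.2
      rcases le_total ‖z - y‖ ‖x - y‖ with hle | hle
      · refine inner_le_of_almost_far hδ0 hδ1 hle ?_ ?_
        · rw [hd]; nlinarith
        · nlinarith
      · rw [real_inner_comm, mul_comm ‖x - y‖]
        refine inner_le_of_almost_far hδ0 hδ1 hle ?_ ?_
        · rw [hd']; nlinarith
        · nlinarith
  let f : Rn n → Rn n := fun x => ‖x - y‖⁻¹ • (x - y)
  have hf1 : ∀ x ∈ G, ‖f x‖ = 1 := fun x hx => by
    simp only [f, norm_smul, norm_inv, norm_norm]
    exact inv_mul_cancel₀ (hpos x hx).ne'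
  have hf2 : ∀ x ∈ G, ∀ z ∈ G, x ≠ z → inner ℝ (f x) (f z) ≤ 1 / 2 + δ := by
    intro x hx z hz hne
    simp only [f, real_inner_smul_left, real_inner_smul_right]
    have hp := mul_pos (hpos x hx) (hpos z hz)
    rw [← mul_assoc, ← mul_inv, inv_mul_le_iff₀ (by rwa [mul_comm]), mul_comm, mul_comm ‖z - y‖]
    exact hinner x hx z hz hne
  have hinj : InjOn f G := by
    intro x hx z hz hxz
    by_contra hne
    have := hf2 x hx z hz hne
    rw [hxz, real_inner_self_eq_norm_sq, hf1 z hz] at this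
    linarith
  have hGle : G.encard ≤ kissingNumber n := by
    rw [← hinj.encard_image]
    refine hδ _ ?_ ?_
    · rintro _ ⟨x, hx, rfl⟩
      simpa using hf1 x hx
    · rintro _ ⟨x, hx, rfl⟩ _ ⟨z, hz, rfl⟩ hne
      exact hf2 x hx z hz fun h => hne (by rw [h])
  calc F.encard = (F \ G).encard + G.encard :=
        (encard_sdiff_add_encard_of_subset (sep_subset _ _)).symm
    _ ≤ 1 + kissingNumber n := add_le_add (encard_le_one_iff_subsingleton.2 hsub) hGle
    _ = kissingNumber n + 1 := add_comm _ _

theorem exists_isLeast_isCoveringConstant (n : ℕ) :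
    ∃ N : ℕ, IsLeast {N : ℕ | IsCoveringConstant n N} N ∧ (N : ℕ∞) ≤ kissingNumber n + 1 := by
  classical
  obtain ⟨K, hK⟩ := ENat.ne_top_iff_exists.1 (kissingNumber_ne_top n)
  have hex : IsCoveringConstant n (K + 1) :=
    isCoveringConstant_of_kissingNumber_add_one (by rw [← hK]; push_cast; rfl)
  have hne : ∃ N, IsCoveringConstant n N := ⟨K + 1, hex⟩
  refine ⟨Nat.find hne, ⟨Nat.find_spec hne, fun N hN => Nat.find_min' hne hN⟩, ?_⟩
  rw [← hK]
  exact_mod_cast Nat.find_min' hne hex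

/-! ### Radial integrals -/

/-- Integration in polar coordinates, for functions with values in `[0, ∞]`. -/
theorem lintegral_toSphere_lintegral_Ioi {E : Type*} [NormedAddCommGroup E] [NormedSpace ℝ E]
    [FiniteDimensional ℝ E] [MeasurableSpace E] [BorelSpace E] [Nontrivial E]
    (μ : Measure E) [μ.IsAddHaarMeasure] {f : E → ℝ≥0∞} (hf : Measurable f) :
    ∫⁻ θ, (∫⁻ s in Ioi (0 : ℝ),
        ENNReal.ofReal (s ^ (Module.finrank ℝ E - 1)) * f (s • (θ : E))) ∂μ.toSphere
      = ∫⁻ y, f y ∂μ := by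
  have hm : Measurable fun p : sphere (0 : E) 1 × Ioi (0 : ℝ) => f ((p.2 : ℝ) • (p.1 : E)) :=
    hf.comp (by fun_prop)
  calc
    _ = ∫⁻ θ, (∫⁻ s : Ioi (0 : ℝ), f ((s : ℝ) • (θ : E))
          ∂(Measure.volumeIoiPow (Module.finrank ℝ E - 1))) ∂μ.toSphere := by
      refine lintegral_congr fun θ => ?_
      rw [Measure.volumeIoiPow, lintegral_withDensity_eq_lintegral_mul _ (by fun_prop)
        (g := fun s : Ioi (0 : ℝ) => f ((s : ℝ) • (θ : E))) (hf.comp (by fun_prop))]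
      exact (lintegral_subtype_comap measurableSet_Ioi fun s : ℝ =>
        ENNReal.ofReal (s ^ (Module.finrank ℝ E - 1)) * f (s • (θ : E))).symm
    _ = ∫⁻ p, f ((p.2 : ℝ) • (p.1 : E))
          ∂(μ.toSphere.prod (Measure.volumeIoiPow (Module.finrank ℝ E - 1))) :=
      (lintegral_prod _ hm.aemeasurable).symm
    _ = ∫⁻ y : ({0}ᶜ : Set E), f y ∂(μ.comap (↑)) := by
      rw [← μ.measurePreserving_homeomorphUnitSphereProd.lintegral_comp_emb
        (Homeomorph.measurableEmbedding _)]
      refine lintegral_congr fun y => ?_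
      have := congrArg Subtype.val ((homeomorphUnitSphereProd E).symm_apply_apply y)
      rw [homeomorphUnitSphereProd_symm_apply_coe] at this
      rw [this]
    _ = ∫⁻ y, f y ∂μ := by
      rw [lintegral_subtype_comap (measurableSet_singleton _).compl, restrict_compl_singleton]

theorem lintegral_Ioi_rpow_neg {a d : ℝ} (ha : 1 < a) (hd : 0 < d) :
    ∫⁻ t in Ioi d, ENNReal.ofReal ((a - 1) * t ^ (-a)) = ENNReal.ofReal (d ^ (1 - a)) := by
  rw [← ofReal_integral_eq_lintegral_ofReal]
  · rw [integral_const_mul, integral_Ioi_rpow_of_lt (by linarith) hd]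
    have : -a + 1 ≠ 0 := by linarith
    congr 1
    rw [show -a + 1 = 1 - a by ring, show a - 1 = -(1 - a) by ring]
    have : 1 - a ≠ 0 := by linarith
    field_simp
  · exact (integrableOn_Ioi_rpow_of_lt (by linarith) hd).const_mul _
  · refine (ae_restrict_iff' measurableSet_Ioi).2 (ae_of_all _ fun t ht => ?_)
    exact mul_nonneg (by linarith) (Real.rpow_nonneg (hd.trans ht).le _)

/-- The integral of `ρ` over all rays issuing from `z` is the Riesz potential
`∫ ρ(y) |y - z| ^ (1 - n) dy`, which is estimated by writing `|y - z| ^ (1 - n)` as the integral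
of `(n - 1) t ^ (-n)` over `t > |y - z|` and exchanging the integrals. -/
theorem lintegral_rays_le {n : ℕ} (hn : 2 ≤ n) {ρ : Rn n → ℝ≥0∞} (hρ : Measurable ρ) (z : Rn n) :
    ∫⁻ θ, (∫⁻ s in Ioi (0 : ℝ), ρ (z + s • (θ : Rn n))) ∂(volume : Measure (Rn n)).toSphere
      ≤ ∫⁻ t in Ioi (0 : ℝ),
          ENNReal.ofReal (((n : ℝ) - 1) * t ^ (-(n : ℝ))) * ∫⁻ y in ball z t, ρ y := by
  have hn' : (1 : ℝ) < n := by exact_mod_cast hn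
  have : Nonempty (Fin n) := ⟨⟨0, by omega⟩⟩
  have hnt : Nontrivial (Rn n) := inferInstance
  let g : Rn n → ℝ≥0∞ := fun y => ρ y * ENNReal.ofReal (‖y - z‖ ^ (1 - (n : ℝ)))
  have hg : Measurable g := by
    refine hρ.mul (Measurable.ennreal_ofReal ?_)
    fun_prop
  let F : Rn n → ℝ → ℝ≥0∞ := fun y t =>
    (ball z t).indicator (fun y => ENNReal.ofReal (((n : ℝ) - 1) * t ^ (-(n : ℝ))) * ρ y) y
  have hF : Measurable (Function.uncurry F) := by
    have : Function.uncurry F = {p : Rn n × ℝ | dist p.1 z < p.2}.indicator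
        fun p => ENNReal.ofReal (((n : ℝ) - 1) * p.2 ^ (-(n : ℝ))) * ρ p.1 := by
      ext p
      simp only [Function.uncurry, F, indicator, mem_ball, mem_ofPred_eq]
    rw [this]
    refine Measurable.indicator ?_ (measurableSet_lt (by fun_prop) (by fun_prop))
    exact (Measurable.ennreal_ofReal (by fun_prop)).mul (hρ.comp measurable_fst)
  calc
    _ = ∫⁻ θ, (∫⁻ s in Ioi (0 : ℝ), ENNReal.ofReal (s ^ (Module.finrank ℝ (Rn n) - 1)) *
          g (z + s • (θ : Rn n))) ∂(volume : Measure (Rn n)).toSphere := by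
      refine lintegral_congr fun θ => setLIntegral_congr_fun measurableSet_Ioi fun s hs => ?_
      have hs' : (0 : ℝ) < s := hs
      have hθ : ‖s • (θ : Rn n)‖ = s := by simp [norm_smul, abs_of_pos hs']
      simp only [g, finrank_euclideanSpace, Fintype.card_fin, add_sub_cancel_left, hθ]
      rw [mul_left_comm, ← ENNReal.ofReal_mul (by positivity), ← Real.rpow_natCast s,
        ← Real.rpow_add hs', Nat.cast_sub (by omega)]
      simp
    _ = ∫⁻ y, g (z + y) :=
      lintegral_toSphere_lintegral_Ioi volume (f := fun y => g (z + y)) (hg.comp (by fun_prop))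
    _ = ∫⁻ y, g y := lintegral_add_left_eq_self g z
    _ ≤ ∫⁻ y, ∫⁻ t in Ioi (0 : ℝ), F y t := by
      refine lintegral_mono fun y => ?_
      -- For `y = z` the factor `0 ^ (1 - n)` is `0` by convention.
      rcases (norm_nonneg (y - z)).eq_or_lt with h0 | hpos
      · simp only [g]
        rw [← h0, Real.zero_rpow (by linarith)]
        simp
      · simp only [g]
        rw [← lintegral_Ioi_rpow_neg hn' hpos, ← lintegral_const_mul _ (by fun_prop)]
        refine le_trans ?_ (lintegral_mono_set (Ioi_subset_Ioi hpos.le))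
        refine setLIntegral_mono' measurableSet_Ioi fun t ht => ?_
        have hy : y ∈ ball z t := mem_ball_iff_norm.2 ht
        simp only [F, indicator_of_mem hy]
        rw [mul_comm]
    _ = ∫⁻ t in Ioi (0 : ℝ), ∫⁻ y, F y t := lintegral_lintegral_swap hF.aemeasurable
    _ = _ := by
      refine lintegral_congr fun t => ?_
      simp only [F]
      rw [lintegral_indicator measurableSet_ball, lintegral_const_mul _ hρ]

/-! ### Hölder's inequality on balls -/

theorem setLIntegral_le_rpow_mul_rpow {α : Type*} [MeasurableSpace α] {μ : Measure α} {n : ℕ}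
    (hn : 2 ≤ n) {ρ : α → ℝ≥0∞} (hρ : Measurable ρ) (B : Set α) :
    ∫⁻ y in B, ρ y ∂μ
      ≤ (∫⁻ y in B, ρ y ^ n ∂μ) ^ (1 / (n : ℝ)) * μ B ^ (1 - 1 / (n : ℝ)) := by
  have hn' : (1 : ℝ) < n := by exact_mod_cast hn
  have h := ENNReal.lintegral_mul_le_Lp_mul_Lq (μ.restrict B)
    (Real.HolderConjugate.conjExponent hn') hρ.aemeasurable
    (g := fun _ => 1) aemeasurable_const
  have hq : 1 / Real.conjExponent (n : ℝ) = 1 - 1 / (n : ℝ) := by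
    have := (Real.HolderConjugate.conjExponent hn').inv_add_inv_eq_one
    rw [one_div, one_div]
    linarith
  rw [hq] at h
  simpa using h

theorem ballVolume_pos (n : ℕ) : 0 < ballVolume n :=
  ENNReal.toReal_pos (measure_ball_pos _ _ one_pos).ne' measure_ball_lt_top.ne

theorem volume_ball_rpow {n : ℕ} (hn : 2 ≤ n) (z : Rn n) {t : ℝ} (ht : 0 < t) :
    volume (ball z t) ^ (1 - 1 / (n : ℝ))
      = ENNReal.ofReal (t ^ ((n : ℝ) - 1) * ballVolume n ^ (1 - 1 / (n : ℝ))) := by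
  have hn' : (1 : ℝ) < n := by exact_mod_cast hn
  have hΩ := ballVolume_pos n
  have he : 0 ≤ 1 - 1 / (n : ℝ) := by
    rw [sub_nonneg, div_le_one (by linarith)]
    exact hn'.le
  rw [Measure.addHaar_ball_of_pos _ _ ht, finrank_euclideanSpace, Fintype.card_fin]
  rw [show volume (ball (0 : Rn n) 1) = ENNReal.ofReal (ballVolume n) from
    (ENNReal.ofReal_toReal measure_ball_lt_top.ne).symm]
  rw [← ENNReal.ofReal_mul (by positivity), ENNReal.ofReal_rpow_of_nonneg (by positivity) he,
    Real.mul_rpow (by positivity) hΩ.le, ← Real.rpow_natCast, ← Real.rpow_mul ht.le]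
  congr 3
  field_simp

/-- The integral over all rays from `z`, cut off outside `B̄(x, R)`: the scales `t < R` contribute
an integral over the balls `B(z, t)`, and the scales `t ≥ R` at most the second term. -/
theorem lintegral_rays_closedBall_le {n : ℕ} (hn : 2 ≤ n) {ρ : Rn n → ℝ≥0∞} (hρ : Measurable ρ)
    (x z : Rn n) {R : ℝ} (hR : 0 < R) :
    ∫⁻ θ, (∫⁻ s in Ioi (0 : ℝ), (closedBall x R).indicator ρ (z + s • (θ : Rn n)))
        ∂(volume : Measure (Rn n)).toSphere
      ≤ (∫⁻ t in Ioo 0 R,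
          ENNReal.ofReal (((n : ℝ) - 1) * ballVolume n ^ (1 - 1 / (n : ℝ)) * t⁻¹) *
            (∫⁻ y in ball z t, ρ y ^ n) ^ (1 / (n : ℝ)))
        + ENNReal.ofReal (ballVolume n ^ (1 - 1 / (n : ℝ))) * (∫⁻ y, ρ y ^ n) ^ (1 / (n : ℝ)) := by
  have hn' : (1 : ℝ) < n := by exact_mod_cast hn
  have : Nonempty (Fin n) := ⟨⟨0, by omega⟩⟩
  have hnt : Nontrivial (Rn n) := inferInstance
  refine (lintegral_rays_le hn (hρ.indicator measurableSet_closedBall) z).trans ?_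
  rw [← Ioo_union_Ici_eq_Ioi hR]
  refine (lintegral_union_le _ _ _).trans (add_le_add ?_ ?_)
  · refine setLIntegral_mono' measurableSet_Ioo fun t ht => ?_
    have ht0 : 0 < t := ht.1
    calc
      _ ≤ ENNReal.ofReal (((n : ℝ) - 1) * t ^ (-(n : ℝ))) *
            ((∫⁻ y in ball z t, ρ y ^ n) ^ (1 / (n : ℝ)) *
              ENNReal.ofReal (t ^ ((n : ℝ) - 1) * ballVolume n ^ (1 - 1 / (n : ℝ)))) := by
        gcongr
        rw [← volume_ball_rpow hn z ht0]
        refine le_trans (lintegral_mono fun y => ?_) (setLIntegral_le_rpow_mul_rpow hn hρ _)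
        exact indicator_le_self _ _ y
      _ = _ := by
        rw [mul_comm (_ ^ _) (ENNReal.ofReal _), ← mul_assoc, ← ENNReal.ofReal_mul
          (mul_nonneg (by linarith) (Real.rpow_nonneg ht0.le _))]
        congr 2
        have : t ^ (-(n : ℝ)) * t ^ ((n : ℝ) - 1) = t⁻¹ := by
          rw [← Real.rpow_add ht0, ← Real.rpow_neg_one]
          congr 1
          ring
        rw [← this]
        ring
  · calc
      _ ≤ ∫⁻ t in Ici R, ENNReal.ofReal (((n : ℝ) - 1) * t ^ (-(n : ℝ))) *
            ∫⁻ y in closedBall x R, ρ y := by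
        refine lintegral_mono fun t => ?_
        refine mul_le_mul_right ?_ _
        rw [← lintegral_indicator measurableSet_closedBall]
        exact setLIntegral_le_lintegral _ _
      _ = ENNReal.ofReal (R ^ (1 - (n : ℝ))) * ∫⁻ y in closedBall x R, ρ y := by
        rw [lintegral_mul_const _ (by fun_prop), setLIntegral_congr Ioi_ae_eq_Ici.symm,
          lintegral_Ioi_rpow_neg hn' hR]
      _ ≤ ENNReal.ofReal (R ^ (1 - (n : ℝ))) * ((∫⁻ y, ρ y ^ n) ^ (1 / (n : ℝ)) *
            ENNReal.ofReal (R ^ ((n : ℝ) - 1) * ballVolume n ^ (1 - 1 / (n : ℝ)))) := by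
        gcongr
        rw [← volume_ball_rpow hn x hR, ← Measure.addHaar_closedBall_eq_addHaar_ball]
        refine (setLIntegral_le_rpow_mul_rpow hn hρ _).trans ?_
        gcongr
        exact Measure.restrict_le_self
      _ = _ := by
        rw [mul_comm (_ ^ _) (ENNReal.ofReal _), ← mul_assoc,
          ← ENNReal.ofReal_mul (Real.rpow_nonneg hR.le _), ← mul_assoc, ← Real.rpow_add hR]
        simp

/-! ### Line integrals along segments -/

theorem Isometry.eVariationOn_inter_Icc {E : Type*} [PseudoEMetricSpace E] {f : ℝ → E}
    (hf : Isometry f) (s : Set ℝ) {a b : ℝ} (ha : a ∈ s) (hb : b ∈ s) :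
    eVariationOn f (s ∩ Icc a b) = ENNReal.ofReal (b - a) := by
  have h : eVariationOn f (s ∩ Icc a b) = eVariationOn (id : ℝ → ℝ) (s ∩ Icc a b) := by
    simp only [eVariationOn, hf.edist_eq, id]
  rw [h]
  exact monotoneOn_id.eVariationOn_eq ha hb

/-- The segment of length `L` issuing from `z` in the direction `θ`. -/
noncomputable def segmentPath {n : ℕ} (z θ : Rn n) {L : ℝ} (hL : 0 ≤ L) : ClosedPath n where
  a := 0
  b := L
  hab := hL
  toFun s := z + s • θ
  cont := by fun_prop

theorem isometry_add_smul {E : Type*} [NormedAddCommGroup E] [NormedSpace ℝ E] (z : E) {θ : E}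
    (hθ : ‖θ‖ = 1) : Isometry fun s : ℝ => z + s • θ := by
  refine Isometry.of_dist_eq fun s t => ?_
  rw [dist_add_left, dist_eq_norm, ← sub_smul, norm_smul, hθ, mul_one, Real.dist_eq,
    Real.norm_eq_abs]

theorem length_segmentPath {n : ℕ} (z : Rn n) {θ : Rn n} (hθ : ‖θ‖ = 1) {L : ℝ} (hL : 0 ≤ L) :
    (segmentPath z θ hL).length = ENNReal.ofReal L := by
  have h := (isometry_add_smul z hθ).eVariationOn_inter_Icc (Icc 0 L)
    (left_mem_Icc.2 hL) (right_mem_Icc.2 hL)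
  rw [inter_self, sub_zero] at h
  exact h

theorem lineIntegral_segmentPath {n : ℕ} (z : Rn n) {θ : Rn n} (hθ : ‖θ‖ = 1) {L : ℝ}
    (hL : 0 ≤ L) (ρ : Rn n → ℝ≥0∞) :
    (segmentPath z θ hL).lineIntegral ρ = ∫⁻ s in Icc 0 L, ρ (z + s • θ) := by
  have hunit : HasConstantSpeedOnWith (fun s : ℝ => z + s • θ) (Icc 0 L) 1 := by
    intro a ha b hb
    rw [(isometry_add_smul z hθ).eVariationOn_inter_Icc _ ha hb, NNReal.coe_one, one_mul]
  rw [ClosedPath.lineIntegral, length_segmentPath z hθ hL, ENNReal.toReal_ofReal hL]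
  refine setLIntegral_congr_fun measurableSet_Icc fun s hs => ?_
  have h0 : (0 : ℝ) ∈ Icc 0 L := left_mem_Icc.2 hL
  have hv := (hasConstantSpeedOnWith_iff_variationOnFromTo_eq.1 hunit).2 h0 hs
  have he := edist_naturalParameterization_eq_zero hunit.hasLocallyBoundedVariationOn h0 hs
  rw [hv, NNReal.coe_one, one_mul, sub_zero] at he
  exact congrArg ρ (edist_eq_zero.1 he)

/-- An admissible density has integral at least `1` along each ray issuing from a point of
`E ∩ B̄(x, r)`, even if it is cut off outside `B̄(x, 2r)`: the ray meets the sphere `S(x, 2r)`. -/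
theorem one_le_lintegral_ray {n : ℕ} {x : Rn n} {E : Set (Rn n)} {r : ℝ} (hr : 0 < r)
    {ρ : Rn n → ℝ≥0∞}
    (hρ : Admissible (joiningPaths (sphere x (2 * r)) (E ∩ closedBall x r) univ) ρ)
    {z θ : Rn n} (hz : z ∈ E ∩ closedBall x r) (hθ : ‖θ‖ = 1) :
    1 ≤ ∫⁻ s in Ioi (0 : ℝ), (closedBall x (2 * r)).indicator ρ (z + s • θ) := by
  have hzx : dist z x ≤ r := hz.2
  obtain ⟨L, hL, hLx⟩ : 2 * r ∈ (fun s : ℝ => dist (z + s • θ) x) '' Icc 0 (3 * r) := by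
    refine intermediate_value_Icc (by positivity) (by fun_prop) ⟨?_, ?_⟩
    · simp only [zero_smul, add_zero]
      linarith
    · have h1 := dist_triangle_left (z + (3 * r) • θ) z x
      have h2 : dist z (z + (3 * r) • θ) = 3 * r := by
        simp [dist_eq_norm, norm_smul, hθ, abs_of_pos hr]
      have h3 := dist_triangle z x (z + (3 * r) • θ)
      rw [dist_comm x] at h3
      linarith
  have hL0 : 0 ≤ L := hL.1
  have hzR : z ∈ closedBall x (2 * r) := mem_closedBall.2 (by linarith)
  have hLR : z + L • θ ∈ closedBall x (2 * r) := mem_closedBall.2 hLx.le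
  have hmem : segmentPath z θ hL0 ∈ joiningPaths (sphere x (2 * r)) (E ∩ closedBall x r) univ := by
    refine ⟨Or.inr ⟨?_, hLx⟩, fun _ _ => mem_univ _⟩
    simpa [segmentPath] using hz
  have h1 := hρ.2 _ hmem (by
    rw [ClosedPath.Rectifiable, length_segmentPath z hθ hL0]
    exact ENNReal.ofReal_ne_top)
  rw [lineIntegral_segmentPath z hθ hL0, ← setLIntegral_congr Ioc_ae_eq_Icc] at h1
  refine (h1.trans ?_).trans (lintegral_mono_set (s := Ioc 0 L) fun s hs => hs.1)
  refine setLIntegral_mono' measurableSet_Ioc fun s hs => ?_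
  have hLpos : 0 < L := hs.1.trans_le hs.2
  have hseg : z + s • θ ∈ closedBall x (2 * r) := by
    have := (convex_closedBall x (2 * r)).add_smul_mem hzR hLR (t := s / L)
      ⟨div_nonneg hs.1.le hL0, (div_le_one hLpos).2 hs.2⟩
    rwa [smul_smul, div_mul_cancel₀ _ hLpos.ne'] at this
  rw [indicator_of_mem hseg]

/-! ### Constants -/

theorem sphereArea_eq (n : ℕ) : sphereArea n = n * ballVolume n := by
  rw [sphereArea, Measure.toSphere_real_apply_univ, finrank_euclideanSpace, Fintype.card_fin]
  rfl

theorem rpow_one_sub_inv_pow {n : ℕ} (hn : n ≠ 0) {a : ℝ} (ha : 0 < a) :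
    (a ^ (1 - 1 / (n : ℝ))) ^ n = a ^ ((n : ℤ) - 1) := by
  have : (n : ℝ) ≠ 0 := by exact_mod_cast hn
  rw [← Real.rpow_natCast, ← Real.rpow_mul ha.le, ← Real.rpow_intCast]
  congr 1
  push_cast
  field_simp

theorem constK_eq {n : ℕ} (hn : n ≠ 0) :
    constK n = (n * ballVolume n / 2 / ballVolume n ^ (1 - 1 / (n : ℝ))) ^ n := by
  have hΩ := ballVolume_pos n
  rw [div_pow, rpow_one_sub_inv_pow hn hΩ, constK, sphereArea_eq, div_pow, zpow_neg,
    zpow_natCast, show 1 - (n : ℤ) = -((n : ℤ) - 1) by ring, zpow_neg]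
  field_simp

theorem constK_pos {n : ℕ} (hn : n ≠ 0) : 0 < constK n := by
  have hΩ := ballVolume_pos n
  have : (0 : ℝ) < n := by exact_mod_cast Nat.pos_of_ne_zero hn
  rw [constK_eq hn]
  positivity

/-! ### Hausdorff content -/

theorem IsMeasureFunction.nonneg {h : ℝ → ℝ} (hh : IsMeasureFunction h) {t : ℝ} (ht : 0 < t) :
    0 ≤ h t := by
  refine le_of_tendsto hh.tendsto_zero ?_
  filter_upwards [Ioo_mem_nhdsGT ht] with s hs
  exact hh.mono hs.1 ht hs.2.le

theorem hausdorffContent_le_of_subset_ball {n : ℕ} {h : ℝ → ℝ} {E : Set (Rn n)} {x : Rn n} {t : ℝ}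
    (ht : 0 < t) (hE : E ⊆ ball x t) : hausdorffContent h E ≤ ENNReal.ofReal (h t) := by
  refine iInf₂_le_of_le {(x, t)} (countable_singleton _) (iInf₂_le_of_le (by simpa using ht)
    (by simpa using hE) ?_)
  rw [tsum_singleton (x, t) fun p : Rn n × ℝ => ENNReal.ofReal (h p.2)]

theorem hausdorffContent_le_of_subset_closedBall {n : ℕ} {h : ℝ → ℝ} (hh : IsMeasureFunction h)
    {E : Set (Rn n)} {x : Rn n} {r : ℝ} (hr : 0 < r) (hE : E ⊆ closedBall x r) :
    hausdorffContent h E ≤ ENNReal.ofReal (h r) := by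
  have hc : Filter.Tendsto (fun t => ENNReal.ofReal (h t)) (nhdsWithin r (Ioi r))
      (nhds (ENNReal.ofReal (h r))) :=
    (ENNReal.continuous_ofReal.tendsto _).comp
      (((hh.cont.continuousAt (Ioi_mem_nhds hr)).tendsto).mono_left nhdsWithin_le_nhds)
  refine ge_of_tendsto hc ?_
  filter_upwards [self_mem_nhdsWithin] with t ht
  exact hausdorffContent_le_of_subset_ball (hr.trans ht)
    (hE.trans (closedBall_subset_ball ht))

/-- A covering with bounded overlap turns local lower bounds for a mass distribution `g` into an
upper bound for the content. -/
theorem mul_hausdorffContent_le {n N : ℕ} (hN : IsCoveringConstant n N) {h : ℝ → ℝ}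
    {A : Set (Rn n)} {t : Rn n → ℝ} (ht : ∀ z ∈ A, 0 < t z) (hbdd : BddAbove (t '' A))
    {c : ℝ≥0∞} {g : Rn n → ℝ≥0∞} (hg : Measurable g)
    (hlow : ∀ z ∈ A, c * ENNReal.ofReal (h (t z)) ≤ ∫⁻ y in ball z (t z), g y) :
    c * hausdorffContent h A ≤ N * ∫⁻ y, g y := by
  obtain ⟨S, hSA, hSc, hcov, hmult⟩ := hN A t ht hbdd
  have : Countable S := hSc
  have hinj : InjOn (fun z => (z, t z)) S := fun z _ w _ h => congrArg Prod.fst h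
  have hcont : hausdorffContent h A ≤ ∑' z : S, ENNReal.ofReal (h (t z)) := by
    refine iInf₂_le_of_le ((fun z => (z, t z)) '' S) (hSc.image _) (iInf₂_le_of_le ?_ ?_ ?_)
    · rintro _ ⟨z, hz, rfl⟩
      exact ht z (hSA hz)
    · simpa using hcov
    · rw [tsum_image (fun p : Rn n × ℝ => ENNReal.ofReal (h p.2)) hinj]
  calc
    c * hausdorffContent h A ≤ ∑' z : S, c * ENNReal.ofReal (h (t z)) := by
      rw [ENNReal.tsum_mul_left]
      gcongr
    _ ≤ ∑' z : S, ∫⁻ y, (ball (z : Rn n) (t z)).indicator g y := by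
      refine ENNReal.tsum_le_tsum fun z => ?_
      rw [lintegral_indicator measurableSet_ball]
      exact hlow z (hSA z.2)
    _ = ∫⁻ y, ∑' z : S, (ball (z : Rn n) (t z)).indicator g y :=
      (lintegral_tsum fun z => (hg.indicator measurableSet_ball).aemeasurable).symm
    _ ≤ ∫⁻ y, N * g y := by
      refine lintegral_mono fun y => ?_
      have hcount : ∑' z : S, (ball (z : Rn n) (t z)).indicator (1 : Rn n → ℝ≥0∞) y ≤ N := by
        have h1 : ∑' z : S, (ball (z : Rn n) (t z)).indicator (1 : Rn n → ℝ≥0∞) y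
            = ∑' z : {z ∈ S | y ∈ ball z (t z)}, (1 : ℝ≥0∞) := by
          rw [tsum_subtype S fun z => (ball z (t z)).indicator (1 : Rn n → ℝ≥0∞) y,
            tsum_subtype {z ∈ S | y ∈ ball z (t z)} fun _ => (1 : ℝ≥0∞)]
          refine tsum_congr fun z => ?_
          by_cases hz : z ∈ S <;> by_cases hy : y ∈ ball z (t z) <;>
            simp [indicator, hz, hy, -mem_ball]
        rw [h1, ENNReal.tsum_set_one]
        exact_mod_cast hmult y
      calc
        _ = (∑' z : S, (ball (z : Rn n) (t z)).indicator (1 : Rn n → ℝ≥0∞) y) * g y := by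
          rw [← ENNReal.tsum_mul_right]
          refine tsum_congr fun z => ?_
          by_cases hy : y ∈ ball (z : Rn n) (t z) <;> simp [indicator, hy, -mem_ball]
        _ ≤ N * g y := by gcongr
    _ = N * ∫⁻ y, g y := lintegral_const_mul _ hg

/-! ### Capacity and content -/

/-- If the tail of the potential is less than half of the area of the sphere, then the small scales
carry the other half. As `h ^ (1 / n)` satisfies the integral condition, `∫_{B(z,t)} ρⁿ` cannot
stay below `dⁿ h(t)` for all `t < 2 r`. -/
theorem exists_lt_lintegral_ball {n : ℕ} (hn : 2 ≤ n) {h : ℝ → ℝ} (hh : IsMeasureFunction h)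
    {x z : Rn n} {E : Set (Rn n)} {r B d : ℝ} (hr : 0 < r) (hd : 0 < d)
    (hint : ∫⁻ t in Ioo 0 (2 * r), ENNReal.ofReal (h t ^ (1 / (n : ℝ)) * t⁻¹) ≤ ENNReal.ofReal B)
    (hdB : ((n : ℝ) - 1) * ballVolume n ^ (1 - 1 / (n : ℝ)) * d * B ≤ n * ballVolume n / 2)
    {ρ : Rn n → ℝ≥0∞}
    (hρ : Admissible (joiningPaths (sphere x (2 * r)) (E ∩ closedBall x r) univ) ρ)
    (htail : ENNReal.ofReal (ballVolume n ^ (1 - 1 / (n : ℝ))) * (∫⁻ y, ρ y ^ n) ^ (1 / (n : ℝ))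
      < ENNReal.ofReal (n * ballVolume n / 2))
    (hz : z ∈ E ∩ closedBall x r) :
    ∃ t ∈ Ioo 0 (2 * r), ENNReal.ofReal (d ^ n * h t) < ∫⁻ y in ball z t, ρ y ^ n := by
  by_contra! hcon
  have hn' : (1 : ℝ) < n := by exact_mod_cast hn
  have hΩ := ballVolume_pos n
  have hW : 0 < ballVolume n ^ (1 - 1 / (n : ℝ)) := Real.rpow_pos_of_pos hΩ _
  have harea : ENNReal.ofReal (n * ballVolume n) ≤
      ∫⁻ θ, (∫⁻ s in Ioi (0 : ℝ), (closedBall x (2 * r)).indicator ρ (z + s • (θ : Rn n)))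
        ∂(volume : Measure (Rn n)).toSphere := by
    calc
      ENNReal.ofReal (n * ballVolume n) = ∫⁻ _, 1 ∂(volume : Measure (Rn n)).toSphere := by
        rw [← sphereArea_eq, sphereArea, lintegral_one, ofReal_measureReal]
      _ ≤ _ := lintegral_mono fun θ => one_le_lintegral_ray hr hρ hz (by simp)
  have hsmall : ∫⁻ t in Ioo 0 (2 * r),
      ENNReal.ofReal (((n : ℝ) - 1) * ballVolume n ^ (1 - 1 / (n : ℝ)) * t⁻¹) *
        (∫⁻ y in ball z t, ρ y ^ n) ^ (1 / (n : ℝ)) ≤ ENNReal.ofReal (n * ballVolume n / 2) := by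
    calc
      _ ≤ ∫⁻ t in Ioo 0 (2 * r),
            ENNReal.ofReal (((n : ℝ) - 1) * ballVolume n ^ (1 - 1 / (n : ℝ)) * d) *
              ENNReal.ofReal (h t ^ (1 / (n : ℝ)) * t⁻¹) := by
        refine setLIntegral_mono' measurableSet_Ioo fun t ht => ?_
        have ht0 : 0 < t := ht.1
        have hht := hh.nonneg ht0
        calc
          _ ≤ ENNReal.ofReal (((n : ℝ) - 1) * ballVolume n ^ (1 - 1 / (n : ℝ)) * t⁻¹) *
                ENNReal.ofReal (d ^ n * h t) ^ (1 / (n : ℝ)) := by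
            gcongr
            exact hcon t ht
          _ = _ := by
            rw [ENNReal.ofReal_rpow_of_nonneg (by positivity) (by positivity),
              Real.mul_rpow (by positivity) hht, one_div,
              Real.pow_rpow_inv_natCast hd.le (by omega), ← one_div,
              ← ENNReal.ofReal_mul (mul_nonneg (mul_nonneg (by linarith) hW.le) (by positivity)),
              ← ENNReal.ofReal_mul (mul_nonneg (mul_nonneg (by linarith) hW.le) hd.le)]
            congr 1
            ring
      _ ≤ ENNReal.ofReal (((n : ℝ) - 1) * ballVolume n ^ (1 - 1 / (n : ℝ)) * d) *
            ENNReal.ofReal B := by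
        rw [lintegral_const_mul' _ _ ENNReal.ofReal_ne_top]
        gcongr
      _ ≤ _ := by
        rw [← ENNReal.ofReal_mul (mul_nonneg (mul_nonneg (by linarith) hW.le) hd.le)]
        exact ENNReal.ofReal_le_ofReal hdB
  have hlt := (harea.trans (lintegral_rays_closedBall_le hn hρ.1 x z (by positivity))).trans_lt
    (ENNReal.add_lt_add_of_le_of_lt (ne_top_of_le_ne_top ENNReal.ofReal_ne_top hsmall) hsmall htail)
  rw [← ENNReal.ofReal_add (by positivity) (by positivity), add_halves] at hlt
  exact lt_irrefl _ hlt

/-- The constant `c h(r) = dⁿ Hⁿ`, where `H = h(r) ^ (1 / n)` and `d` solves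
`(n - 1) Ω ^ (1 - 1 / n) d A H = n Ω / 2`. -/
theorem half_area_div_pow_mul_pow {n : ℕ} (hn : 2 ≤ n) {Ω A H : ℝ} (hΩ : 0 < Ω) (hA : 0 < A)
    (hH : 0 < H) :
    (n * Ω / 2 / (((n : ℝ) - 1) * Ω ^ (1 - 1 / (n : ℝ)) * (A * H))) ^ n * H ^ n
      = Ω / (2 ^ n * A ^ n * (((n : ℝ) - 1) / n) ^ n) := by
  have hn' : (1 : ℝ) < n := by exact_mod_cast hn
  have hn1 : 0 < (n : ℝ) - 1 := by linarith
  have hn0 : (0 : ℝ) < n := by linarith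
  have hW := rpow_one_sub_inv_pow (n := n) (by omega) hΩ
  have hz : Ω ^ ((n : ℤ) - 1) * Ω = Ω ^ n := by
    rw [← zpow_add_one₀ hΩ.ne']
    simp
  have hzp : 0 < Ω ^ ((n : ℤ) - 1) := zpow_pos hΩ _
  simp only [div_pow, mul_pow, hW]
  rw [← hz]
  field_simp

/-- The estimate for a single admissible density. -/
theorem hausdorffContent_div_le {n N : ℕ} (hn : 2 ≤ n) (hN : IsCoveringConstant n N) {h : ℝ → ℝ}
    (hh : IsMeasureFunction h) {x : Rn n} {E : Set (Rn n)} {r A : ℝ} (hr : 0 < r) (hA : 0 < A)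
    (hint : ∫⁻ t in Ioo 0 (2 * r), ENNReal.ofReal (h t ^ (1 / (n : ℝ)) * t⁻¹)
      ≤ ENNReal.ofReal (A * h r ^ (1 / (n : ℝ))))
    {ρ : Rn n → ℝ≥0∞}
    (hρ : Admissible (joiningPaths (sphere x (2 * r)) (E ∩ closedBall x r) univ) ρ) :
    hausdorffContent h (E ∩ closedBall x r) / ENNReal.ofReal (h r)
      ≤ ENNReal.ofReal (constM n A N) * ∫⁻ y, ρ y ^ n := by
  have hn' : (1 : ℝ) < n := by exact_mod_cast hn
  have hn1 : 0 < (n : ℝ) - 1 := by linarith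
  have hΩ := ballVolume_pos n
  have hW : 0 < ballVolume n ^ (1 - 1 / (n : ℝ)) := Real.rpow_pos_of_pos hΩ _
  have hK := constK_pos (n := n) (by omega)
  have hle := hausdorffContent_le_of_subset_closedBall hh hr
    (inter_subset_right : E ∩ closedBall x r ⊆ closedBall x r)
  -- If `h r = 0`, the content vanishes and the quotient is `0 / 0 = 0`.
  rcases (hh.nonneg hr).eq_or_lt with h0 | hpos
  · rw [← h0, ENNReal.ofReal_zero] at hle
    rw [nonpos_iff_eq_zero.1 hle, ENNReal.zero_div]
    exact zero_le
  rcases le_or_gt (ENNReal.ofReal (constK n)) (∫⁻ y, ρ y ^ n) with hbig | hsmall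
  · calc
      _ ≤ (1 : ℝ≥0∞) := ENNReal.div_le_of_le_mul (by rwa [one_mul])
      _ = ENNReal.ofReal (1 / constK n) * ENNReal.ofReal (constK n) := by
        rw [← ENNReal.ofReal_mul (by positivity), one_div, inv_mul_cancel₀ hK.ne',
          ENNReal.ofReal_one]
      _ ≤ _ := by
        gcongr
        exact le_max_right _ _
  · have htail : ENNReal.ofReal (ballVolume n ^ (1 - 1 / (n : ℝ))) *
        (∫⁻ y, ρ y ^ n) ^ (1 / (n : ℝ)) < ENNReal.ofReal (n * ballVolume n / 2) := by
      have h1 := ENNReal.rpow_lt_rpow hsmall (show 0 < 1 / (n : ℝ) by positivity)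
      rw [constK_eq (by omega), ENNReal.ofReal_rpow_of_nonneg (by positivity) (by positivity),
        one_div, Real.pow_rpow_inv_natCast (by positivity) (by omega)] at h1
      calc
        _ < ENNReal.ofReal (ballVolume n ^ (1 - 1 / (n : ℝ))) *
              ENNReal.ofReal (n * ballVolume n / 2 / ballVolume n ^ (1 - 1 / (n : ℝ))) := by
          rw [one_div]
          refine (ENNReal.mul_lt_mul_iff_right (ENNReal.ofReal_pos.2 (by simpa using hW)).ne'
            ENNReal.ofReal_ne_top).2 ?_
          simpa using h1
        _ = _ := by
          rw [← ENNReal.ofReal_mul hW.le, mul_div_cancel₀ _ hW.ne']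
    set H : ℝ := h r ^ (1 / (n : ℝ)) with hHdef
    have hH : 0 < H := Real.rpow_pos_of_pos hpos _
    have hHn : H ^ n = h r := by
      rw [hHdef, one_div, Real.rpow_inv_natCast_pow hpos.le (by omega)]
    -- The largest `d` for which the small scales carry at most half of the area of the sphere.
    set d : ℝ := n * ballVolume n / 2 /
      (((n : ℝ) - 1) * ballVolume n ^ (1 - 1 / (n : ℝ)) * (A * H)) with hd_def
    have hd : 0 < d := by positivity
    have hdB : ((n : ℝ) - 1) * ballVolume n ^ (1 - 1 / (n : ℝ)) * d * (A * H)
        ≤ n * ballVolume n / 2 := by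
      rw [hd_def]
      refine le_of_eq ?_
      field_simp
    have hdn := half_area_div_pow_mul_pow hn hΩ hA hH
    rw [← hd_def, hHn] at hdn
    have hex : ∀ z : Rn n, ∃ t : ℝ, z ∈ E ∩ closedBall x r → t ∈ Ioo 0 (2 * r) ∧
        ENNReal.ofReal (d ^ n * h t) < ∫⁻ y in ball z t, ρ y ^ n := by
      intro z
      by_cases hz : z ∈ E ∩ closedBall x r
      · obtain ⟨t, ht⟩ := exists_lt_lintegral_ball hn hh hr hd hint hdB hρ htail hz
        exact ⟨t, fun _ => ht⟩
      · exact ⟨0, fun h => absurd h hz⟩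
    choose t ht using hex
    have hmain := mul_hausdorffContent_le hN (h := h) (A := E ∩ closedBall x r) (t := t)
      (c := ENNReal.ofReal (d ^ n)) (g := fun y => ρ y ^ n) (fun z hz => (ht z hz).1.1)
      ⟨2 * r, by rintro _ ⟨z, hz, rfl⟩; exact (ht z hz).1.2.le⟩ (hρ.1.pow_const n)
      (fun z hz => by
        rw [← ENNReal.ofReal_mul (by positivity)]
        exact (ht z hz).2.le)
    have hcoef : 1 / (d ^ n * h r) * N ≤ constM n A N := by
      refine le_trans (le_of_eq ?_) (le_max_left _ _)
      rw [hdn]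
      field_simp
    calc
      _ ≤ ENNReal.ofReal (1 / (d ^ n * h r)) * (N * ∫⁻ y, ρ y ^ n) := by
        refine ENNReal.div_le_of_le_mul ?_
        calc
          _ = ENNReal.ofReal (1 / (d ^ n * h r)) * ENNReal.ofReal (h r) *
                (ENNReal.ofReal (d ^ n) * hausdorffContent h (E ∩ closedBall x r)) := by
            rw [← mul_assoc, ← ENNReal.ofReal_mul (by positivity),
              ← ENNReal.ofReal_mul (by positivity),
              show 1 / (d ^ n * h r) * h r * d ^ n = 1 by field_simp,
              ENNReal.ofReal_one, one_mul]
          _ ≤ ENNReal.ofReal (1 / (d ^ n * h r)) * ENNReal.ofReal (h r) *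
                (N * ∫⁻ y, ρ y ^ n) := by gcongr
          _ = _ := by ring
      _ = ENNReal.ofReal (1 / (d ^ n * h r) * N) * ∫⁻ y, ρ y ^ n := by
        rw [ENNReal.ofReal_mul (by positivity), ENNReal.ofReal_natCast, mul_assoc]
      _ ≤ _ := by gcongr

theorem mainTheorem5 (n : ℕ) (hn : 2 ≤ n) :
    (∃ N : ℕ, IsLeast {N : ℕ | IsCoveringConstant n N} N ∧ (N : ℕ∞) ≤ kissingNumber n + 1) ∧
    ∀ N : ℕ, IsCoveringConstant n N →
      ∀ (h : ℝ → ℝ) (A r₀ : ℝ), IsMeasureFunction h → 0 < A → 0 < r₀ →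
        (∀ r, 0 < r → r ≤ r₀ →
          ∫⁻ t in Ioo 0 (2 * r), ENNReal.ofReal (h t ^ (1 / (n : ℝ)) * t⁻¹)
            ≤ ENNReal.ofReal (A * h r ^ (1 / (n : ℝ)))) →
        ∀ E : Set (Rn n), IsClosed E → ∀ (x : Rn n) (r : ℝ), 0 < r → r ≤ r₀ →
          hausdorffContent h (E ∩ closedBall x r) / ENNReal.ofReal (h r)
            ≤ ENNReal.ofReal (constM n A N) * localCap x E r := by
  refine ⟨exists_isLeast_isCoveringConstant n, ?_⟩
  intro N hN h A r₀ hh hA _ hint E _ x r hr hr₀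
  have hM : 0 < constM n A N :=
    lt_max_of_lt_right (one_div_pos.2 (constK_pos (by omega)))
  rw [← ENNReal.div_le_iff' (ENNReal.ofReal_pos.2 hM).ne' ENNReal.ofReal_ne_top]
  refine le_iInf₂ fun ρ hρ => ?_
  rw [ENNReal.div_le_iff' (ENNReal.ofReal_pos.2 hM).ne' ENNReal.ofReal_ne_top]
  exact hausdorffContent_div_le hn hN hh hr hA (hint r hr hr₀) hρ
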